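/- There is an absolute constant $C > 0$ such that the following holds. Let $u, b \in \mathbb{N}$ and let $S \subseteq \mathbb{Z}_2^u$ satisfy $2 \le |S| \le 2^b$. Let $T$ be drawn uniformly at random from the set of all linear maps $\mathbb{Z}_2^u \to \mathbb{Z}_2^b$. Then the expected size of a largest bin, when the elements of $S$ are placed into the $2^b$ bins $y \in \mathbb{Z}_2^b$ according to $T$, satisfies $$\mathbb{E}_T\Big[\max_{y \in \mathbb{Z}_2^b} |T^{-1}(y) \cap S|\Big] \le C \log_2 |S| .$$ -/

import Mathlib

open scoped BigOperators

/-- The vector space `ℤ₂ᵘ`. -/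
abbrev BinVec (u : ℕ) : Type := Fin u → ZMod 2

/-- The set of all linear transformations `ℤ₂ᵘ → ℤ₂ᵇ`. -/
abbrev LinMaps (u b : ℕ) : Type := BinVec u →ₗ[ZMod 2] BinVec b

noncomputable instance LinMaps.instFintype (u b : ℕ) : Fintype (LinMaps u b) :=
  Fintype.ofInjective (fun T : LinMaps u b => (T : BinVec u → BinVec b))
    DFunLike.coe_injective

/-- The set `T⁻¹(y) ∩ S` of the balls of `S` that `T` places into the bin `y`. -/
def bin {u b : ℕ} (T : LinMaps u b) (S : Finset (BinVec u)) (y : BinVec b) :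
    Finset (BinVec u) :=
  S.filter (fun x => T x = y)

/-- The size of a largest bin, `max_y |T⁻¹(y) ∩ S|`. -/
def lbin {u b : ℕ} (T : LinMaps u b) (S : Finset (BinVec u)) : ℕ :=
  Finset.univ.sup' Finset.univ_nonempty (fun y : BinVec b => (bin T S y).card)

/-- The expected size of a largest bin for `T` drawn uniformly from all linear maps:
the average of `lbin T S` over the finite set of linear maps. -/
noncomputable def expectedLbin (u b : ℕ) (S : Finset (BinVec u)) : ℝ :=
  (∑ T : LinMaps u b, (lbin T S : ℝ)) / (Fintype.card (LinMaps u b) : ℝ)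

/-! Fix `K` of density about `1/#S` and let `G y` be 2 to the number of `x ∈ S` with `y + T x ∈ K`.
Moving a largest bin onto any point of `K` gives `G ≥ 2 ^ lbin` at `#K` shifts, so `lbin` is bounded
by `log (𝔼 G)` plus `log (2 ^ b / #K)`. In expectation over `T`, `log (𝔼 G)` is at most the sum of
the logs of the single-point means, as if the images of `S` were independent
(`expect_log_expect_prod_le`); this sum is O(1). -/

open Finset in
/-- A shifted product of two functions on a finite group has, averaged over the shift, the product of
the means as its mean; Jensen's inequality for the logarithm. -/
lemma expect_log_expect_mul_shift_le {W : Type*} [AddCommGroup W] [Fintype W]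
    (f g : W → ℝ) (hf : ∀ y, 0 < f y) (hg : ∀ y, 0 < g y) :
    𝔼 t, Real.log (𝔼 y, f y * g (y + t)) ≤ Real.log (𝔼 y, f y) + Real.log (𝔼 y, g y) := by
  have hf' : 0 < 𝔼 y, f y := expect_pos (fun y _ => hf y) univ_nonempty
  have hg' : 0 < 𝔼 y, g y := expect_pos (fun y _ => hg y) univ_nonempty
  set a := (𝔼 y, f y) * 𝔼 y, g y with ha
  have hapos : 0 < a := mul_pos hf' hg'
  have hmean : 𝔼 t, 𝔼 y, f y * g (y + t) = a := by
    rw [expect_comm, ha, expect_mul]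
    refine expect_congr rfl fun y _ => ?_
    rw [← mul_expect]
    congr 1
    exact Fintype.expect_equiv (Equiv.addLeft y) _ _ fun t => rfl
  have hpt : ∀ t, Real.log (𝔼 y, f y * g (y + t)) ≤
      Real.log a + ((𝔼 y, f y * g (y + t)) / a - 1) := by
    intro t
    have hz : 0 < 𝔼 y, f y * g (y + t) :=
      expect_pos (fun y _ => mul_pos (hf y) (hg _)) univ_nonempty
    -- Jensen via the tangent line of `log` at the mean `a`.
    have := Real.log_le_sub_one_of_pos (div_pos hz hapos)
    rw [Real.log_div hz.ne' hapos.ne'] at this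
    linarith
  calc 𝔼 t, Real.log (𝔼 y, f y * g (y + t))
      ≤ 𝔼 t, (Real.log a + ((𝔼 y, f y * g (y + t)) / a - 1)) := expect_le_expect fun t _ => hpt t
    _ = Real.log a := by
      rw [expect_add_distrib, expect_sub_distrib, ← expect_div, hmean, div_self hapos.ne',
        Fintype.expect_const, Fintype.expect_const]
      ring
    _ = _ := Real.log_mul hf'.ne' hg'.ne'

open Finset in
/-- For a uniformly random linear map `x ↦ ∑ i, x i • c i`, the logarithm of the mean of the product
of the functions `F x` shifted by the images of `x` is subadditive in expectation. -/
lemma expect_log_expect_prod_le {W : Type*} [AddCommGroup W] [Fintype W] [Module (ZMod 2) W]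
    (u : ℕ) (F : (Fin u → ZMod 2) → W → ℝ) (hF : ∀ x y, 0 < F x y) :
    𝔼 c : Fin u → W, Real.log (𝔼 y, ∏ x, F x (y + ∑ i, x i • c i)) ≤
      ∑ x, Real.log (𝔼 y, F x y) := by
  induction u with
  | zero => simp
  | succ u ih =>
    have hprod : ∀ (t : W) (c : Fin u → W) (y : W),
        ∏ x : Fin (u + 1) → ZMod 2, F x (y + ∑ i, x i • (Fin.cons t c : Fin (u + 1) → W) i) =
        ∏ x : Fin u → ZMod 2, (F (Fin.cons 0 x) (y + ∑ i, x i • c i) *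
          F (Fin.cons 1 x) (y + ∑ i, x i • c i + t)) := by
      intro t c y
      rw [← (Fin.consEquiv fun _ : Fin (u + 1) => ZMod 2).prod_comp, Fintype.prod_prod_type_right]
      refine prod_congr rfl fun x _ => ?_
      have h2 : ∀ h : ZMod 2 → ℝ, ∏ e, h e = h 0 * h 1 := fun h => Fin.prod_univ_two h
      rw [h2]
      simp [Fin.consEquiv, Fin.sum_univ_succ, add_assoc, add_comm t]
    have hsum : ∑ x : Fin (u + 1) → ZMod 2, Real.log (𝔼 y, F x y) =
        ∑ x : Fin u → ZMod 2,
          (Real.log (𝔼 y, F (Fin.cons 0 x) y) + Real.log (𝔼 y, F (Fin.cons 1 x) y)) := by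
      rw [← (Fin.consEquiv fun _ : Fin (u + 1) => ZMod 2).sum_comp, Fintype.sum_prod_type_right]
      exact sum_congr rfl fun x _ => Fin.sum_univ_two _
    rw [← Fintype.expect_equiv (Fin.consEquiv fun _ : Fin (u + 1) => W)
      (fun p : W × (Fin u → W) => Real.log (𝔼 y, ∏ x : Fin u → ZMod 2,
        (F (Fin.cons 0 x) (y + ∑ i, x i • p.2 i) *
          F (Fin.cons 1 x) (y + ∑ i, x i • p.2 i + p.1)))) _
      (fun p => by simp only [← hprod]; rfl), ← univ_product_univ, expect_product, hsum]
    -- With the image `t` of the first basis vector fixed, induct on the paired functions; only then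
    -- average over `t`.
    calc _ ≤ 𝔼 t : W, ∑ x : Fin u → ZMod 2,
          Real.log (𝔼 y, F (Fin.cons 0 x) y * F (Fin.cons 1 x) (y + t)) :=
        expect_le_expect fun t _ =>
          ih (fun x y => F (Fin.cons 0 x) y * F (Fin.cons 1 x) (y + t))
            fun x y => mul_pos (hF _ _) (hF _ _)
      _ = ∑ x : Fin u → ZMod 2, 𝔼 t : W,
          Real.log (𝔼 y, F (Fin.cons 0 x) y * F (Fin.cons 1 x) (y + t)) := expect_sum_comm _ _ _
      _ ≤ _ := sum_le_sum fun x _ =>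
        expect_log_expect_mul_shift_le _ _ (hF _) (hF _)

open Finset in
/-- The largest bin is controlled by the mean of `2 ^ #{x ∈ S | y + T x ∈ K}` over `y`. -/
lemma lbin_mul_log_two_le {u b : ℕ} (T : LinMaps u b) (S : Finset (BinVec u))
    (K : Finset (BinVec b)) (hK : K.Nonempty) :
    (lbin T S : ℝ) * Real.log 2 ≤ Real.log (2 ^ b / #K) +
      Real.log (𝔼 y, ∏ x, if x ∈ S ∧ y + T x ∈ K then (2 : ℝ) else 1) := by
  obtain ⟨y₀, -, hy₀⟩ := exists_mem_eq_sup' univ_nonempty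
    (fun y : BinVec b => (bin T S y).card)
  have hl : lbin T S = #(bin T S y₀) := hy₀
  set G : BinVec b → ℝ := fun y => ∏ x, if x ∈ S ∧ y + T x ∈ K then (2 : ℝ) else 1 with hG
  have hGone : ∀ y, 1 ≤ G y := fun y => by
    refine Finset.one_le_prod fun x _ => ?_
    split_ifs <;> norm_num
  have hlow : ∀ k ∈ K, (2 : ℝ) ^ lbin T S ≤ G (k - y₀) := by
    intro k hk
    rw [hl, ← prod_const]
    calc ∏ _x ∈ bin T S y₀, (2 : ℝ)
        = ∏ x ∈ bin T S y₀, if x ∈ S ∧ k - y₀ + T x ∈ K then (2 : ℝ) else 1 := by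
          refine prod_congr rfl fun x hx => ?_
          obtain ⟨hxS, hxy⟩ := mem_filter.1 hx
          rw [if_pos ⟨hxS, by simpa [hxy] using hk⟩]
      _ ≤ G (k - y₀) := by
          refine prod_le_prod_of_subset_of_one_le (subset_univ _) (fun x _ => ?_) fun x _ _ => ?_
          all_goals split_ifs <;> norm_num
  have hsum : (#K : ℝ) * 2 ^ lbin T S ≤ ∑ y, G y := by
    calc (#K : ℝ) * 2 ^ lbin T S = ∑ _k ∈ K, (2 : ℝ) ^ lbin T S := by simp
      _ ≤ ∑ k ∈ K, G (k - y₀) := sum_le_sum hlow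
      _ ≤ ∑ k, G (k - y₀) := sum_le_sum_of_subset_of_nonneg (subset_univ _)
          fun y _ _ => zero_le_one.trans (hGone _)
      _ = ∑ y, G y := (Equiv.subRight y₀).sum_comp G
  have hKpos : (0 : ℝ) < #K := by exact_mod_cast hK.card_pos
  have hcard : (Fintype.card (BinVec b) : ℝ) = 2 ^ b := by simp [BinVec, ZMod.card]
  have hE : 0 < 𝔼 y, G y := expect_pos (fun y _ => zero_lt_one.trans_le (hGone y)) univ_nonempty
  rw [← Real.log_pow, ← Real.log_mul (by positivity) hE.ne']
  refine Real.log_le_log (by positivity) ?_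
  rw [Fintype.expect_eq_sum_div_card, hcard, div_mul_div_comm, mul_comm (2 ^ b : ℝ),
    mul_div_mul_right _ _ (by positivity), le_div_iff₀ hKpos, mul_comm]
  exact hsum

-- A larger `K` lowers the cost of hitting it but raises the load; each `x ∈ S` contributes `log (1
-- + #K / 2 ^ b) ≤ #K / 2 ^ b`.
open Finset in
lemma expectedLbin_mul_log_two_le (u b : ℕ) (S : Finset (BinVec u))
    (K : Finset (BinVec b)) (hK : K.Nonempty) :
    expectedLbin u b S * Real.log 2 ≤ Real.log (2 ^ b / #K) + #S * (#K / 2 ^ b) := by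
  have hcard : (Fintype.card (BinVec b) : ℝ) = 2 ^ b := by simp [BinVec, ZMod.card]
  let e := ((Pi.basisFun (ZMod 2) (Fin u)).constr ℕ : (Fin u → BinVec b) ≃ₗ[ℕ] LinMaps u b)
  have he : ∀ c x, e c x = ∑ i, x i • c i := fun c x => by
    simp [e, Module.Basis.constr_apply_fintype]
  have hpos : ∀ (x : BinVec u) (y : BinVec b), 0 < if x ∈ S ∧ y ∈ K then (2 : ℝ) else 1 :=
    fun x y => by split_ifs <;> norm_num
  have hlog : ∀ x, Real.log (𝔼 y, if x ∈ S ∧ y ∈ K then (2 : ℝ) else 1) ≤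
      if x ∈ S then (#K / 2 ^ b : ℝ) else 0 := by
    intro x
    split_ifs with hx
    · refine (Real.log_le_sub_one_of_pos
        (expect_pos (fun y _ => hpos x y) univ_nonempty)).trans_eq ?_
      have h1 : ∀ y, (if x ∈ S ∧ y ∈ K then (2 : ℝ) else 1) = 1 + if y ∈ K then 1 else 0 := by
        intro y
        by_cases hy : y ∈ K <;> norm_num [hx, hy]
      simp only [h1, expect_add_distrib, Fintype.expect_const]
      rw [Fintype.expect_eq_sum_div_card, hcard]
      simp
    · simp [hx]
  calc expectedLbin u b S * Real.log 2 = 𝔼 T : LinMaps u b, (lbin T S : ℝ) * Real.log 2 := by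
        rw [expectedLbin, ← Fintype.expect_eq_sum_div_card, expect_mul]
    _ ≤ 𝔼 T : LinMaps u b, (Real.log (2 ^ b / #K) +
          Real.log (𝔼 y, ∏ x, if x ∈ S ∧ y + T x ∈ K then (2 : ℝ) else 1)) :=
        expect_le_expect fun T _ => lbin_mul_log_two_le T S K hK
    _ = Real.log (2 ^ b / #K) + 𝔼 T : LinMaps u b,
          Real.log (𝔼 y, ∏ x, if x ∈ S ∧ y + T x ∈ K then (2 : ℝ) else 1) := by
        rw [expect_add_distrib, expect_const univ_nonempty]
    _ = Real.log (2 ^ b / #K) + 𝔼 c : Fin u → BinVec b,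
          Real.log (𝔼 y, ∏ x, if x ∈ S ∧ y + ∑ i, x i • c i ∈ K then (2 : ℝ) else 1) := by
        congr 1
        refine (Fintype.expect_equiv e.toEquiv _ _ fun c => ?_).symm
        simp [he]
    _ ≤ Real.log (2 ^ b / #K) + ∑ x, Real.log (𝔼 y, if x ∈ S ∧ y ∈ K then (2 : ℝ) else 1) := by
        gcongr
        exact expect_log_expect_prod_le u (fun x y => if x ∈ S ∧ y ∈ K then (2 : ℝ) else 1) hpos
    _ ≤ Real.log (2 ^ b / #K) + ∑ x, if x ∈ S then (#K / 2 ^ b : ℝ) else 0 := by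
        gcongr with x
        exact hlog x
    _ = _ := by simp

theorem theorem1 :
    ∃ C : ℝ, 0 < C ∧ ∀ (u b : ℕ) (S : Finset (BinVec u)),
      2 ≤ S.card → S.card ≤ 2 ^ b →
        expectedLbin u b S ≤ C * Real.logb 2 (S.card : ℝ) := by
  refine ⟨4, by norm_num, fun u b S h2 hb => ?_⟩
  have hcard : Fintype.card (BinVec b) = 2 ^ b := by simp [BinVec, ZMod.card]
  have hS : 0 < S.card := by omega
  -- Only the size of `K` matters; this one balances the two terms.
  obtain ⟨K, -, hKc⟩ := Finset.exists_subset_card_eq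
    (s := (Finset.univ : Finset (BinVec b))) (n := 2 ^ b / S.card)
    (by rw [Finset.card_univ, hcard]; exact Nat.div_le_self _ _)
  have hKpos : 0 < K.card := hKc ▸ Nat.div_pos hb hS
  have hupper : (S.card : ℝ) * K.card ≤ 2 ^ b := by
    rw [hKc]
    exact_mod_cast Nat.mul_div_le _ _
  have hlower : (2 : ℝ) ^ b ≤ 2 * S.card * K.card := by
    have h1 := Nat.lt_mul_div_succ (2 ^ b) hS
    rw [← hKc] at h1
    -- Rounding down loses at most a factor 2, since `K.card ≥ 1`.
    have h3 : 2 ^ b ≤ 2 * S.card * K.card := by nlinarith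
    exact_mod_cast h3
  have hSr : (2 : ℝ) ≤ S.card := by exact_mod_cast h2
  have hKr : (0 : ℝ) < K.card := by exact_mod_cast hKpos
  have hmain := expectedLbin_mul_log_two_le u b S K (Finset.card_pos.1 hKpos)
  have hfirst : Real.log (2 ^ b / K.card) ≤ Real.log 2 + Real.log S.card := by
    rw [← Real.log_mul (by norm_num) (by positivity)]
    exact Real.log_le_log (by positivity) ((div_le_iff₀ hKr).2 hlower)
  have hsecond : (S.card : ℝ) * (K.card / 2 ^ b) ≤ 1 := by
    rw [← mul_div_assoc]
    exact (div_le_one (by positivity)).2 hupper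
  -- `1 ≤ 2 log 2`, so `log 2 + log #S + 1 ≤ 4 log #S`, whence the constant 4.
  have hlog2 : 0.6931471803 < Real.log 2 := Real.log_two_gt_d9
  have hlogS : Real.log 2 ≤ Real.log S.card := Real.log_le_log (by norm_num) hSr
  rw [Real.logb, ← mul_div_assoc, le_div_iff₀ (by linarith)]
  linarith
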